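/- Let $P^*=(p_1^*,\dots,p_n^*)$ be a probability distribution with $p_i^*>0$ for all $i$, let $P^0=(p_1^0,\dots,p_n^0)$ be a probability distribution ($p_i^0\ge 0$, $\sum_i p_i^0=1$), and let $J$ be a set of pairs of indices $(i,j)$ with $1\le j<i\le n$. For $i\ne j$ let $\gamma^{ji}\in\mathbb{R}^n$ be the vector with coordinate $-1$ at $j$, $+1$ at $i$, and $0$ elsewhere. Let $\mathcal{K}_J$ be the class of the detailed-balance master equations $$\frac{dP}{dt}=\sum_{i>j}w_{ij}^*\left(\frac{p_j}{p_j^*}-\frac{p_i}{p_i^*}\right)\gamma^{ji},\qquad w_{ij}^*\ge 0 \text{ for } (i,j)\in J,\quad w_{ij}^*=0 \text{ for } (i,j)\notin J,$$ and let $\Phi_J(P^0)$ be the set of all values $P(t)$, $t>0$, of solutions $P:[0,\infty)\to\mathbb{R}^n$ of all equations of the class $\mathcal{K}_J$ with $P(0)=P^0$. Let $$\mathbf{Q}_J(P^0,P^*)=\mathrm{cone}\left\{\gamma^{ji}\,\mathrm{sign}\left(\frac{p_j^0}{p_j^*}-\frac{p_i^0}{p_i^*}\right)\ \Big|\ (i,j)\in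 J\right\},$$ where $\mathrm{cone}$ denotes the set of all linear combinations with non-negative coefficients (it is $\{0\}$ for the empty set). If $\frac{p_j^0}{p_j^*}-\frac{p_i^0}{p_i^*}\neq 0$ for all $(i,j)\in J$, then there exists a neighbourhood $U$ of $P^0$ in $\mathbb{R}^n$ such that $$(P^0+\mathbf{Q}_J(P^0,P^*))\cap U=\Phi_J(P^0)\cap U .$$ -/

import Mathlib

open scoped Topology

namespace MarkovOrder

/-- The stoichiometric vector `γ^{ji}` of the transition `A_j → A_i` (for `i ≠ j`):
coordinate `-1` at `j`, `1` at `i`, and `0` elsewhere. -/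
def gammaVec {n : ℕ} (j i : Fin n) : Fin n → ℝ :=
  fun k => if k = j then -1 else if k = i then 1 else 0

/-- The right-hand side of the Kolmogorov equation with detailed balance in quasichemical form,
`∑_{i > j} w*_{ij} (p_j / p*_j - p_i / p*_i) γ^{ji}`, with equilibrium fluxes `w*_{ij}` (only the
values with `i > j` matter). -/
noncomputable def velocity {n : ℕ} (Pstar : Fin n → ℝ) (w : Fin n → Fin n → ℝ)
    (P : Fin n → ℝ) : Fin n → ℝ :=
  ∑ i : Fin n, ∑ j ∈ Finset.univ.filter (fun j : Fin n => j < i),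
    (w i j * (P j / Pstar j - P i / Pstar i)) • gammaVec j i

/-- `w` gives the equilibrium fluxes of an equation of the class `K_J`: nonnegative, and zero
for the transitions outside `J`. -/
def IsFlux {n : ℕ} (J : Set (Fin n × Fin n)) (w : Fin n → Fin n → ℝ) : Prop :=
  (∀ i j, 0 ≤ w i j) ∧ ∀ i j, (i, j) ∉ J → w i j = 0

/-- `P` is a solution on `[0, ∞)` of the equation with fluxes `w` and initial value `P0`. -/
def IsSolution {n : ℕ} (Pstar : Fin n → ℝ) (w : Fin n → Fin n → ℝ) (P0 : Fin n → ℝ)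
    (P : ℝ → Fin n → ℝ) : Prop :=
  P 0 = P0 ∧ ∀ t : ℝ, 0 ≤ t → HasDerivWithinAt P (velocity Pstar w (P t)) (Set.Ici 0) t

/-- `Φ_J(P⁰)`: all values `P(t)`, `t > 0`, of solutions of the equations of the class `K_J` with
`P(0) = P⁰`. -/
def reachable {n : ℕ} (Pstar : Fin n → ℝ) (J : Set (Fin n × Fin n)) (P0 : Fin n → ℝ) :
    Set (Fin n → ℝ) :=
  {x | ∃ w : Fin n → Fin n → ℝ, IsFlux J w ∧
    ∃ P : ℝ → Fin n → ℝ, IsSolution Pstar w P0 P ∧ ∃ t : ℝ, 0 < t ∧ P t = x}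

/-- The cone of possible velocities
`Q_J(P, P*) = cone {γ^{ji} sign (p_j / p*_j - p_i / p*_i) | (i, j) ∈ J}`. -/
noncomputable def velocityCone {n : ℕ} (J : Set (Fin n × Fin n)) (P Pstar : Fin n → ℝ) :
    PointedCone ℝ (Fin n → ℝ) :=
  PointedCone.hull ℝ
    {v | ∃ i j : Fin n, (i, j) ∈ J ∧ v = Real.sign (P j / Pstar j - P i / Pstar i) • gammaVec j i}

end MarkovOrder

/-! Number the pairs of `J` by `e`, with linear forces `ℓ e` and directions `γ e`. Since no force
vanishes at `P0`, the cone consists of the sums of `b e • γ e` with `b e * ℓ e P0 ≥ 0`. Cone into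
reachable set: at time one the displacement has coefficients `w e * ℓ e y`, with `y` the time
integral of the state. This map of `w` has an invertible diagonal derivative at `w = 0`, so it hits
all small `b` (`eventually_exists_trajectory`); `eventually_coeff_mem` makes `b` small. Reachable
set into cone: fluxes and time are unbounded, so a trajectory might leave and return. The quadratic
divergence forbids this: where forces are bounded away from zero, speed is at most a constant times
dissipation. A path ending near `P0` is therefore short, its forces keep their signs, and
integration gives the cone (`eventually_trajectory_mem_cone`). -/

namespace MarkovOrder

/-! ### Small constant fluxes: the time-one map. -/

section Dynamics

variable {ι E : Type*} [Fintype ι] [NormedAddCommGroup E] [NormedSpace ℝ E]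

/-- The operator `(x, y) ↦ (∑ w_e ℓ_e(x) γ_e, x)`, generating the linear flow
`x' = ∑ w_e ℓ_e(x) γ_e` together with the time integral `y` of `x`. -/
noncomputable def fluxGenerator (γ : ι → E) (ℓ : ι → E →L[ℝ] ℝ) (w : ι → ℝ) :
    (E × E) →L[ℝ] (E × E) :=
  (ContinuousLinearMap.inr ℝ E E).comp (ContinuousLinearMap.fst ℝ E E) +
    ∑ e, w e • ((ℓ e).comp (ContinuousLinearMap.fst ℝ E E)).smulRight (γ e, (0 : E))

theorem fluxGenerator_apply (γ : ι → E) (ℓ : ι → E →L[ℝ] ℝ) (w : ι → ℝ) (z : E × E) :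
    fluxGenerator γ ℓ w z = (∑ e, (w e * ℓ e z.1) • γ e, z.1) := by
  ext <;> simp [fluxGenerator, Prod.fst_sum, Prod.snd_sum, mul_smul]

/-- The trajectory of `fluxGenerator` issued from `(x₀, 0)`. -/
noncomputable def fluxFlow (γ : ι → E) (ℓ : ι → E →L[ℝ] ℝ) (x₀ : E) (w : ι → ℝ) (t : ℝ) : E × E :=
  NormedSpace.exp (t • fluxGenerator γ ℓ w) (x₀, 0)

theorem fluxFlow_zero (γ : ι → E) (ℓ : ι → E →L[ℝ] ℝ) (x₀ : E) (w : ι → ℝ) :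
    fluxFlow γ ℓ x₀ w 0 = (x₀, 0) := by
  simp [fluxFlow]

variable [CompleteSpace E]

theorem hasDerivAt_fluxFlow (γ : ι → E) (ℓ : ι → E →L[ℝ] ℝ) (x₀ : E) (w : ι → ℝ) (t : ℝ) :
    HasDerivAt (fluxFlow γ ℓ x₀ w)
      (∑ e, (w e * ℓ e (fluxFlow γ ℓ x₀ w t).1) • γ e, (fluxFlow γ ℓ x₀ w t).1) t := by
  have h := (hasDerivAt_exp_smul_const' (𝕂 := ℝ) (fluxGenerator γ ℓ w) t).clm_apply
    (hasDerivAt_const t ((x₀, 0) : E × E))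
  rw [map_zero, add_zero, mul_apply_eq_comp, fluxGenerator_apply] at h
  exact h

/-- Linearity of `ℓ e` moves the time integral inside the force, giving explicit displacement
coefficients. -/
theorem fluxFlow_fst (γ : ι → E) (ℓ : ι → E →L[ℝ] ℝ) (x₀ : E) (w : ι → ℝ) (t : ℝ) :
    (fluxFlow γ ℓ x₀ w t).1 = x₀ + ∑ e, (w e * ℓ e (fluxFlow γ ℓ x₀ w t).2) • γ e := by
  have hd : ∀ s, HasDerivAt (fun s => (fluxFlow γ ℓ x₀ w s).1 -
      ∑ e, (w e * ℓ e (fluxFlow γ ℓ x₀ w s).2) • γ e) 0 s := fun s => by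
    have h := hasDerivAt_fluxFlow γ ℓ x₀ w s
    have h1 := (ContinuousLinearMap.fst ℝ E E).hasFDerivAt.comp_hasDerivAt s h
    have h2 := (ContinuousLinearMap.snd ℝ E E).hasFDerivAt.comp_hasDerivAt s h
    have h3 := HasDerivAt.fun_sum (u := Finset.univ) fun e _ =>
      (((ℓ e).hasFDerivAt.comp_hasDerivAt s h2).const_mul (w e)).smul_const (γ e)
    have h4 := h1.sub h3
    simp only [ContinuousLinearMap.coe_fst', ContinuousLinearMap.coe_snd', sub_self] at h4
    exact h4
  have h := is_const_of_deriv_eq_zero (fun s => (hd s).differentiableAt)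
    (fun s => (hd s).deriv) t 0
  simp only [fluxFlow_zero, map_zero, mul_zero, zero_smul, Finset.sum_const_zero, sub_zero] at h
  exact sub_eq_iff_eq_add.mp h

theorem fluxFlow_zero_flux_snd (γ : ι → E) (ℓ : ι → E →L[ℝ] ℝ) (x₀ : E) (t : ℝ) :
    (fluxFlow γ ℓ x₀ 0 t).2 = t • x₀ := by
  have hd : ∀ s, HasDerivAt (fun s => (fluxFlow γ ℓ x₀ 0 s).2 - s • x₀) 0 s := fun s => by
    have h := (ContinuousLinearMap.snd ℝ E E).hasFDerivAt.comp_hasDerivAt s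
      (hasDerivAt_fluxFlow γ ℓ x₀ 0 s)
    have h4 := h.sub ((hasDerivAt_id s).smul_const x₀)
    have h5 : (fluxFlow γ ℓ x₀ 0 s).1 = x₀ := by simpa using fluxFlow_fst γ ℓ x₀ 0 s
    simp only [ContinuousLinearMap.coe_snd', h5, one_smul, sub_self] at h4
    exact h4
  have h := is_const_of_deriv_eq_zero (fun s => (hd s).differentiableAt)
    (fun s => (hd s).deriv) t 0
  simpa [fluxFlow_zero, sub_eq_zero] using h

theorem hasStrictFDerivAt_fluxFlow (γ : ι → E) (ℓ : ι → E →L[ℝ] ℝ) (x₀ : E) :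
    ∃ D : (ι → ℝ) →L[ℝ] E × E, HasStrictFDerivAt (fun w => fluxFlow γ ℓ x₀ w 1) D 0 := by
  have hA : AnalyticAt ℝ (fun w : ι → ℝ => fluxGenerator γ ℓ w) 0 := by
    unfold fluxGenerator
    refine analyticAt_const.add (Finset.univ.analyticAt_fun_sum fun e _ => ?_)
    exact ((ContinuousLinearMap.proj (R := ℝ) (φ := fun _ : ι => ℝ) e).analyticAt 0).smul
      analyticAt_const
  have hexp := (NormedSpace.exp_analytic (𝕂 := ℝ) (fluxGenerator γ ℓ 0)).comp hA
  have h := hexp.hasStrictFDerivAt.clm_apply (hasStrictFDerivAt_const ((x₀, 0) : E × E) 0)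
  refine ⟨_, h.congr_of_eventuallyEq (Filter.Eventually.of_forall fun w => ?_)⟩
  simp [fluxFlow]

/-- Every small displacement `∑ b_e γ_e` is attained by the flow `x' = ∑ w_e ℓ_e(x) γ_e` at time
one, for constant fluxes `w_e` having the sign of `b_e ℓ_e(x₀)`. -/
theorem eventually_exists_trajectory (γ : ι → E) (ℓ : ι → E →L[ℝ] ℝ) (x₀ : E)
    (hne : ∀ e, ℓ e x₀ ≠ 0) :
    ∀ᶠ b in 𝓝 (0 : ι → ℝ), (∀ e, 0 ≤ b e * ℓ e x₀) → ∃ w : ι → ℝ, (∀ e, 0 ≤ w e) ∧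
      ∃ x : ℝ → E, x 0 = x₀ ∧ (∀ t, HasDerivAt x (∑ e, (w e * ℓ e (x t)) • γ e) t) ∧
        x 1 = x₀ + ∑ e, b e • γ e := by
  obtain ⟨D, hD⟩ := hasStrictFDerivAt_fluxFlow γ ℓ x₀
  have hf : ∀ e, HasStrictFDerivAt (fun w => ℓ e (fluxFlow γ ℓ x₀ w 1).2)
      ((ℓ e).comp ((ContinuousLinearMap.snd ℝ E E).comp D)) 0 := fun e =>
    (ℓ e).hasStrictFDerivAt.comp 0 ((ContinuousLinearMap.snd ℝ E E).hasStrictFDerivAt.comp 0 hD)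
  have hf0 : ∀ e, ℓ e (fluxFlow γ ℓ x₀ 0 1).2 = ℓ e x₀ := fun e => by
    rw [fluxFlow_zero_flux_snd, one_smul]
  -- The factor `w e` vanishes at the base point, so the product rule removes the unknown derivative
  -- `D`.
  have hG : HasStrictFDerivAt (fun (w : ι → ℝ) e => w e * ℓ e (fluxFlow γ ℓ x₀ w 1).2)
      (ContinuousLinearMap.pi fun e =>
        ℓ e x₀ • ContinuousLinearMap.proj (R := ℝ) (φ := fun _ : ι => ℝ) e) 0 := by
    rw [hasStrictFDerivAt_pi]
    intro e
    have h := ((ContinuousLinearMap.proj (R := ℝ) (φ := fun _ : ι => ℝ)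
      e).hasStrictFDerivAt (x := 0)).mul (hf e)
    refine h.congr_fderiv ?_
    simp [hf0]
  have hsurj : (ContinuousLinearMap.pi fun e =>
      ℓ e x₀ • ContinuousLinearMap.proj (R := ℝ) (φ := fun _ : ι => ℝ) e).range = ⊤ := by
    refine LinearMap.range_eq_top.2 fun b => ⟨fun e => b e / ℓ e x₀, ?_⟩
    ext e
    simp [mul_div_cancel₀ _ (hne e)]
  have hmap := hG.map_nhds_eq_of_surj hsurj
  have hN : ∀ᶠ w in 𝓝 (0 : ι → ℝ), ∀ e, 0 < ℓ e (fluxFlow γ ℓ x₀ w 1).2 * ℓ e x₀ := by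
    refine Filter.eventually_all.2 fun e => ?_
    have hc : ContinuousAt (fun w => ℓ e (fluxFlow γ ℓ x₀ w 1).2 * ℓ e x₀) 0 :=
      (hf e).continuousAt.mul continuousAt_const
    refine hc.eventually_mem (isOpen_Ioi.mem_nhds ?_)
    simpa [hf0] using hne e
  have himg := Filter.image_mem_map (m := fun (w : ι → ℝ) e =>
    w e * ℓ e (fluxFlow γ ℓ x₀ w 1).2) hN
  rw [hmap] at himg
  simp only [Pi.zero_apply, zero_mul] at himg
  filter_upwards [himg]
  rintro _ ⟨w, hw, rfl⟩ hb
  refine ⟨w, fun e => ?_, fun t => (fluxFlow γ ℓ x₀ w t).1, by simp [fluxFlow_zero], fun t => ?_,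
    fluxFlow_fst γ ℓ x₀ w 1⟩
  · have h := hb e
    rw [mul_assoc] at h
    exact nonneg_of_mul_nonneg_left h (hw e)
  · exact (ContinuousLinearMap.fst ℝ E E).hasFDerivAt.comp_hasDerivAt t
      (hasDerivAt_fluxFlow γ ℓ x₀ w t)

end Dynamics

/-! ### Arbitrary fluxes and times: dissipation bounds the path length. -/

section Lyapunov

variable {ι E : Type*} [Fintype ι] [NormedAddCommGroup E] [NormedSpace ℝ E]

theorem exists_pos_le_abs (f : ι → ℝ) (hf : ∀ e, f e ≠ 0) : ∃ δ > 0, ∀ e, δ ≤ |f e| := by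
  cases isEmpty_or_nonempty ι
  · exact ⟨1, one_pos, fun e => isEmptyElim e⟩
  · obtain ⟨e, he⟩ := Finite.exists_min fun e => |f e|
    exact ⟨_, abs_pos.2 (hf e), he⟩

theorem antitoneOn_lyapunov {γ : ι → E} {ℓ : ι → E →L[ℝ] ℝ} {H : E → ℝ} {H' : E → E →L[ℝ] ℝ}
    (hH : ∀ x, HasFDerivAt H (H' x) x) (hγ : ∀ x e, H' x (γ e) = -ℓ e x)
    {w : ι → ℝ} (hw : ∀ e, 0 ≤ w e) {x : ℝ → E}
    (hx : ∀ t, 0 ≤ t → HasDerivWithinAt x (∑ e, (w e * ℓ e (x t)) • γ e) (Set.Ici 0) t) :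
    (∀ t, 0 ≤ t → HasDerivWithinAt (H ∘ x) (-∑ e, w e * ℓ e (x t) ^ 2) (Set.Ici 0) t) ∧
      AntitoneOn (H ∘ x) (Set.Ici 0) := by
  have hd : ∀ t, 0 ≤ t →
      HasDerivWithinAt (H ∘ x) (-∑ e, w e * ℓ e (x t) ^ 2) (Set.Ici 0) t := fun t ht => by
    refine ((hH (x t)).comp_hasDerivWithinAt t (hx t ht)).congr_deriv ?_
    simp only [map_sum, map_smul, hγ, smul_eq_mul, ← Finset.sum_neg_distrib]
    exact Finset.sum_congr rfl fun e _ => by ring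
  refine ⟨hd, antitoneOn_of_hasDerivWithinAt_nonpos (f' := fun t => -∑ e, w e * ℓ e (x t) ^ 2)
    (convex_Ici 0) (fun t ht => (hd t ht).continuousWithinAt)
    (fun t ht => (hd t (interior_subset ht)).mono interior_subset) fun t _ => ?_⟩
  exact neg_nonpos.2 (Finset.sum_nonneg fun e _ => mul_nonneg (hw e) (sq_nonneg _))

/-- The displacement of a trajectory is the integral of its velocity. -/
theorem trajectory_eq_add_sum [CompleteSpace E] {γ : ι → E} {ℓ : ι → E →L[ℝ] ℝ} {w : ι → ℝ}
    {x : ℝ → E}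
    (hx : ∀ t, 0 ≤ t → HasDerivWithinAt x (∑ e, (w e * ℓ e (x t)) • γ e) (Set.Ici 0) t)
    {t : ℝ} (ht : 0 ≤ t) :
    x t = x 0 + ∑ e, (w e * ∫ s in (0 : ℝ)..t, ℓ e (x s)) • γ e := by
  have hc : ContinuousOn x (Set.Icc 0 t) := fun s hs =>
    (hx s hs.1).continuousWithinAt.mono Set.Icc_subset_Ici_self
  have hcℓ : ∀ e, ContinuousOn (fun s => ℓ e (x s)) (Set.uIcc 0 t) := fun e => by
    rw [Set.uIcc_of_le ht]
    exact (ℓ e).continuous.comp_continuousOn hc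
  have hi : ∀ e, IntervalIntegrable (fun s => (w e * ℓ e (x s)) • γ e) MeasureTheory.volume 0 t :=
    fun e => ((continuousOn_const.mul (hcℓ e)).smul continuousOn_const).intervalIntegrable
  have h := intervalIntegral.integral_eq_sub_of_hasDeriv_right_of_le ht hc
    (fun s hs => (hx s hs.1.le).mono fun r hr => hs.1.le.trans (le_of_lt hr))
    (by simpa only [Finset.sum_fn] using IntervalIntegrable.sum Finset.univ fun e _ => hi e)
  rw [intervalIntegral.integral_finsetSum fun e _ => hi e] at h
  simp only [intervalIntegral.integral_smul_const, intervalIntegral.integral_const_mul] at h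
  rw [h]
  abel

/-- If `H` is a Lyapunov function with `dH(γ_e) = -ℓ_e`, then trajectories of
`x' = ∑ w_e ℓ_e(x) γ_e`, with arbitrary non-negative fluxes, that come close to their initial
point `x₀` do so inside the cone of initial velocities. -/
theorem eventually_trajectory_mem_cone [CompleteSpace E] (γ : ι → E) (ℓ : ι → E →L[ℝ] ℝ)
    (H : E → ℝ) (H' : E → E →L[ℝ] ℝ)
    (hH : ∀ x, HasFDerivAt H (H' x) x) (hγ : ∀ x e, H' x (γ e) = -ℓ e x) (x₀ : E)
    (hne : ∀ e, ℓ e x₀ ≠ 0) :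
    ∀ᶠ y in 𝓝 x₀, ∀ w : ι → ℝ, (∀ e, 0 ≤ w e) → ∀ x : ℝ → E, x 0 = x₀ →
      (∀ t, 0 ≤ t → HasDerivWithinAt x (∑ e, (w e * ℓ e (x t)) • γ e) (Set.Ici 0) t) →
      ∀ t, 0 ≤ t → x t = y → ∃ b : ι → ℝ, (∀ e, 0 ≤ b e * ℓ e x₀) ∧ y = x₀ + ∑ e, b e • γ e := by
  -- Halving leaves room: a force within `δ` of its value at `x₀` keeps its sign and has size at
  -- least `δ`.
  obtain ⟨δ, hδ, hδℓ⟩ := exists_pos_le_abs (fun e => ℓ e x₀ / 2)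
    fun e => div_ne_zero (hne e) two_ne_zero
  have hnear : ∀ᶠ z in 𝓝 x₀, ∀ e, |ℓ e z - ℓ e x₀| < δ := by
    refine Filter.eventually_all.2 fun e => ?_
    have hc : Continuous fun z => |ℓ e z - ℓ e x₀| := by fun_prop
    exact hc.continuousAt.eventually_lt continuousAt_const (by simpa using hδ)
  obtain ⟨r, hr, hball⟩ := Metric.eventually_nhds_iff.1 hnear
  have hsign : ∀ z, dist z x₀ < r → ∀ e, δ ≤ |ℓ e z| ∧ 0 ≤ ℓ e z * ℓ e x₀ := fun z hz e => by
    have h1 := abs_lt.1 (hball hz e)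
    have h2 := hδℓ e
    rcases lt_or_gt_of_ne (hne e) with h | h
    · rw [abs_of_neg (by linarith)] at h2
      exact ⟨le_abs.2 (Or.inr (by linarith)),
        mul_nonneg_of_nonpos_of_nonpos (by linarith) h.le⟩
    · rw [abs_of_pos (by linarith)] at h2
      exact ⟨le_abs.2 (Or.inl (by linarith)), mul_nonneg (by linarith) h.le⟩
  obtain ⟨C, hC, hγC⟩ : ∃ C > 0, ∀ e, ‖γ e‖ ≤ C :=
    ⟨∑ e, ‖γ e‖ + 1, by positivity, fun e => by
      linarith [Finset.single_le_sum (fun i _ => norm_nonneg (γ i)) (Finset.mem_univ e)]⟩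
  have hU : ∀ᶠ y in 𝓝 x₀, C / δ * (H x₀ - H y) < r := by
    have hc : ContinuousAt (fun y => C / δ * (H x₀ - H y)) x₀ :=
      continuousAt_const.mul (continuousAt_const.sub (hH x₀).continuousAt)
    exact hc.eventually_lt continuousAt_const (by simpa using hr)
  filter_upwards [hU] with y hy w hw x hx0 hx t ht hxt
  obtain ⟨hHd, hHanti⟩ := antitoneOn_lyapunov hH hγ hw hx
  have hstay : ∀ s ∈ Set.Icc 0 t, dist (x s) x₀ < r := by
    -- The slope `ε` makes the barrier grow strictly faster than the distance to `x₀`, as the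
    -- comparison theorem requires.
    obtain ⟨ε, hε, hεr⟩ : ∃ ε > 0, C / δ * (H x₀ - H y) + ε * (1 + t) < r := by
      refine ⟨(r - C / δ * (H x₀ - H y)) / (2 * (1 + t)), by
        have : 0 < r - C / δ * (H x₀ - H y) := by linarith
        positivity, ?_⟩
      have h1t : (1 + t) ≠ 0 := by positivity
      have : (r - C / δ * (H x₀ - H y)) / (2 * (1 + t)) * (1 + t)
        = (r - C / δ * (H x₀ - H y)) / 2 := by field_simp
      linarith
    have hBr : ∀ s ∈ Set.Icc 0 t, C / δ * (H x₀ - H (x s)) + ε * (1 + s) < r := fun s hs => by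
      have h1 : H y ≤ H (x s) := hxt ▸ hHanti (Set.mem_Ici.2 hs.1) (Set.mem_Ici.2 ht) hs.2
      have h2 : C / δ * (H x₀ - H (x s)) ≤ C / δ * (H x₀ - H y) := by gcongr
      have h3 : ε * (1 + s) ≤ ε * (1 + t) := by gcongr; exact hs.2
      linarith
    intro s hs
    have hmain := image_norm_le_of_norm_deriv_right_lt_deriv_boundary' (a := 0) (b := t)
      (f := fun s => x s - x₀) (f' := fun s => ∑ e, (w e * ℓ e (x s)) • γ e)
      (B := fun s => C / δ * (H x₀ - H (x s)) + ε * (1 + s))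
      (B' := fun s => C / δ * (∑ e, w e * ℓ e (x s) ^ 2) + ε)
      (fun s hs => ((hx s hs.1).continuousWithinAt.mono Set.Icc_subset_Ici_self).sub
        continuousWithinAt_const)
      (fun s hs => ((hx s hs.1).mono (Set.Ici_subset_Ici.2 hs.1)).sub_const _)
      (by simpa [hx0] using hε.le)
      (fun s hs => by
        have := (hHd s hs.1).continuousWithinAt.mono (fun r (hr : r ∈ Set.Icc 0 t) => hr.1)
        exact (continuousWithinAt_const.mul (continuousWithinAt_const.sub this)).add
          (by fun_prop))
      (fun s hs => by
        have h1 := (((hHd s hs.1).mono (Set.Ici_subset_Ici.2 hs.1)).const_sub (H x₀)).const_mul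
          (C / δ)
        have h2 := (((hasDerivWithinAt_id s (Set.Ici s)).const_add 1).const_mul ε)
        exact (h1.add h2).congr_deriv (by simp))
      -- The speed bound is needed only where the distance equals the barrier; there the point lies
      -- in the ball, so the force bounds apply.
      (fun s hs hsB => by
        have hsr : dist (x s) x₀ < r := by
          rw [dist_eq_norm, hsB]
          exact hBr s (Set.Ico_subset_Icc_self hs)
        have : ‖∑ e, (w e * ℓ e (x s)) • γ e‖ ≤ C / δ * ∑ e, w e * ℓ e (x s) ^ 2 := by
          rw [Finset.mul_sum]
          refine norm_sum_le_of_le _ fun e _ => ?_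
          rw [norm_smul, norm_mul, Real.norm_of_nonneg (hw e), Real.norm_eq_abs]
          have hle : |ℓ e (x s)| ≤ ℓ e (x s) ^ 2 / δ := by
            rw [le_div_iff₀ hδ, ← sq_abs, sq]
            exact mul_le_mul_of_nonneg_left (hsign _ hsr e).1 (abs_nonneg _)
          calc w e * |ℓ e (x s)| * ‖γ e‖ ≤ w e * (ℓ e (x s) ^ 2 / δ) * C := by
                have := hw e
                gcongr
                exact hγC e
            _ = C / δ * (w e * ℓ e (x s) ^ 2) := by ring
        linarith) hs
    rw [dist_eq_norm]
    exact hmain.trans_lt (hBr s hs)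
  refine ⟨fun e => w e * ∫ s in (0 : ℝ)..t, ℓ e (x s), fun e => ?_, ?_⟩
  · rw [mul_assoc, ← intervalIntegral.integral_mul_const]
    exact mul_nonneg (hw e) (intervalIntegral.integral_nonneg ht fun s hs =>
      (hsign _ (hstay s hs) e).2)
  · rw [← hxt, ← hx0]
    exact trajectory_eq_add_sum hx ht

/-- Near `x₀`, the coefficients of a displacement in the cone of initial velocities are small. -/
theorem eventually_coeff_mem (γ : ι → E) (ℓ : ι → E →L[ℝ] ℝ) (L : E →L[ℝ] ℝ) (x₀ : E)
    (hL : ∀ e, L (γ e) = -ℓ e x₀) (hne : ∀ e, ℓ e x₀ ≠ 0) {N : Set (ι → ℝ)} (hN : N ∈ 𝓝 0) :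
    ∀ᶠ y in 𝓝 x₀, ∀ b : ι → ℝ, (∀ e, 0 ≤ b e * ℓ e x₀) → y = x₀ + ∑ e, b e • γ e → b ∈ N := by
  obtain ⟨δ, hδ, hδℓ⟩ := exists_pos_le_abs (fun e => ℓ e x₀) hne
  obtain ⟨ρ, hρ, hball⟩ := Metric.mem_nhds_iff.1 hN
  have hU : ∀ᶠ y in 𝓝 x₀, L (x₀ - y) < ρ * δ := by
    have hc : ContinuousAt (fun y => L (x₀ - y)) x₀ := by fun_prop
    exact hc.eventually_lt continuousAt_const (by simpa using mul_pos hρ hδ)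
  filter_upwards [hU] with y hy b hb hyb
  -- All terms are nonnegative, so the sum bounds each coefficient even if the `γ e` are linearly
  -- dependent.
  have hsum : ∑ e, b e * ℓ e x₀ < ρ * δ := by
    refine lt_of_eq_of_lt ?_ hy
    rw [hyb]
    simp [hL]
  refine hball ?_
  rw [mem_ball_zero_iff, pi_norm_lt_iff hρ]
  intro e
  rw [Real.norm_eq_abs]
  refine lt_of_mul_lt_mul_right ?_ hδ.le
  calc |b e| * δ ≤ |b e| * |ℓ e x₀| := mul_le_mul_of_nonneg_left (hδℓ e) (abs_nonneg _)
    _ = b e * ℓ e x₀ := by rw [← abs_mul, abs_of_nonneg (hb e)]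
    _ ≤ ∑ e, b e * ℓ e x₀ :=
      Finset.single_le_sum (f := fun e => b e * ℓ e x₀) (fun i _ => hb i) (Finset.mem_univ e)
    _ < ρ * δ := hsum

end Lyapunov

/-! ### Specialization to detailed-balance master equations. -/

/-- The thermodynamic force `p_j / p*_j - p_i / p*_i` of the pair `e = (i, j)`. -/
noncomputable def force {n : ℕ} (Pstar : Fin n → ℝ) (e : Fin n × Fin n) :
    (Fin n → ℝ) →L[ℝ] ℝ :=
  (Pstar e.2)⁻¹ • ContinuousLinearMap.proj e.2 - (Pstar e.1)⁻¹ • ContinuousLinearMap.proj e.1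

theorem force_apply {n : ℕ} (Pstar : Fin n → ℝ) (e : Fin n × Fin n) (P : Fin n → ℝ) :
    force Pstar e P = P e.2 / Pstar e.2 - P e.1 / Pstar e.1 := by
  simp [force, div_eq_inv_mul]

theorem velocity_eq_sum {n : ℕ} (Pstar : Fin n → ℝ) {J : Set (Fin n × Fin n)} [Fintype J]
    (hJ : ∀ i j : Fin n, (i, j) ∈ J → j < i) {w : Fin n → Fin n → ℝ}
    (hw : ∀ i j, (i, j) ∉ J → w i j = 0) (P : Fin n → ℝ) :
    velocity Pstar w P =
      ∑ e : J, (w e.1.1 e.1.2 * force Pstar e P) • gammaVec e.1.2 e.1.1 := by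
  simp only [velocity, Finset.sum_filter]
  rw [← Fintype.sum_prod_type' (fun i j : Fin n => if j < i then
      (w i j * (P j / Pstar j - P i / Pstar i)) • gammaVec j i else 0),
    ← Finset.sum_subset (Finset.subset_univ J.toFinset)]
  · rw [Finset.sum_subtype J.toFinset (fun x => Set.mem_toFinset)]
    refine Finset.sum_congr rfl fun e _ => ?_
    rw [if_pos (hJ _ _ e.2), force_apply]
  · rintro ⟨i, j⟩ _ he
    simp [hw i j (by simpa using he)]

theorem mem_velocityCone_iff {n : ℕ} (Pstar P0 : Fin n → ℝ) {J : Set (Fin n × Fin n)} [Fintype J]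
    (hne : ∀ e : J, force Pstar e P0 ≠ 0) (v : Fin n → ℝ) :
    v ∈ velocityCone J P0 Pstar ↔ ∃ b : J → ℝ, (∀ e : J, 0 ≤ b e * force Pstar e P0) ∧
      v = ∑ e : J, b e • gammaVec e.1.2 e.1.1 := by
  classical
  constructor
  · intro hv
    refine Submodule.span_induction ?_ ?_ ?_ ?_ hv
    · rintro _ ⟨i, j, hij, rfl⟩
      refine ⟨Pi.single ⟨(i, j), hij⟩ (Real.sign (P0 j / Pstar j - P0 i / Pstar i)),
        fun e => ?_, ?_⟩
      · rcases eq_or_ne e ⟨(i, j), hij⟩ with rfl | he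
        · simpa [force_apply] using Real.sign_mul_nonneg _
        · simp [Pi.single_eq_of_ne he]
      · rw [Finset.sum_eq_single ⟨(i, j), hij⟩]
        · simp
        · intro e _ he
          simp [Pi.single_eq_of_ne he]
        · simp
    · exact ⟨0, by simp, by simp⟩
    · rintro _ _ _ _ ⟨b, hb, rfl⟩ ⟨c, hc, rfl⟩
      refine ⟨b + c, fun e => ?_, ?_⟩
      · rw [Pi.add_apply, add_mul]
        exact add_nonneg (hb e) (hc e)
      · simp [add_smul, Finset.sum_add_distrib]
    · rintro r _ _ ⟨b, hb, rfl⟩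
      refine ⟨(r : ℝ) • b, fun e => ?_, ?_⟩
      · rw [Pi.smul_apply, smul_eq_mul, mul_assoc]
        exact mul_nonneg r.2 (hb e)
      · rw [Finset.smul_sum]
        refine Finset.sum_congr rfl fun e _ => ?_
        rw [Pi.smul_apply, smul_assoc]
        rfl
  · rintro ⟨b, hb, rfl⟩
    refine Submodule.sum_mem _ fun e _ => ?_
    have hd := hne e
    -- A nonzero force has sign `±1`, whose square is one.
    have hs : b e = b e * Real.sign (force Pstar e P0) * Real.sign (force Pstar e P0) := by
      rcases lt_or_gt_of_ne hd with h | h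
      · simp [Real.sign_of_neg h]
      · simp [Real.sign_of_pos h]
    have hnn : 0 ≤ b e * Real.sign (force Pstar e P0) := by
      rcases lt_or_gt_of_ne hd with h | h
      · rw [Real.sign_of_neg h]
        have := nonpos_of_mul_nonneg_left (hb e) h
        linarith
      · rw [Real.sign_of_pos h, mul_one]
        exact nonneg_of_mul_nonneg_left (hb e) h
    rw [hs, mul_smul]
    refine Submodule.smul_mem _ (⟨_, hnn⟩ : {c : ℝ // 0 ≤ c}) (Submodule.subset_span ?_)
    exact ⟨e.1.1, e.1.2, e.2, by rw [force_apply]⟩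

/-- The quadratic divergence `∑ p_i² / (2 p*_i)`, up to an additive constant. -/
noncomputable def quadDivergence {n : ℕ} (Pstar P : Fin n → ℝ) : ℝ :=
  ∑ i, (Pstar i)⁻¹ / 2 * P i ^ 2

/-- The differential of `quadDivergence`. -/
noncomputable def quadDivergenceDeriv {n : ℕ} (Pstar P : Fin n → ℝ) : (Fin n → ℝ) →L[ℝ] ℝ :=
  ∑ i, (P i / Pstar i) • ContinuousLinearMap.proj i

theorem hasFDerivAt_quadDivergence {n : ℕ} (Pstar P : Fin n → ℝ) :
    HasFDerivAt (quadDivergence Pstar) (quadDivergenceDeriv Pstar P) P := by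
  refine HasFDerivAt.fun_sum fun i _ => ?_
  refine (((hasFDerivAt_apply (𝕜 := ℝ) i P).pow 2).const_mul ((Pstar i)⁻¹ / 2)).congr_fderiv ?_
  ext v
  simp
  ring

theorem quadDivergenceDeriv_gammaVec {n : ℕ} (Pstar P : Fin n → ℝ) {e : Fin n × Fin n}
    (he : e.2 < e.1) :
    quadDivergenceDeriv Pstar P (gammaVec e.2 e.1) = -force Pstar e P := by
  have h : gammaVec e.2 e.1 = Pi.single e.1 1 - Pi.single e.2 (1 : ℝ) := by
    ext k
    simp only [gammaVec, Pi.sub_apply, Pi.single_apply]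
    split_ifs with h1 h2 <;> first | (exact absurd (h1.symm.trans h2) he.ne) | simp
  rw [h, map_sub, force_apply]
  simp [quadDivergenceDeriv, Pi.single_apply]

end MarkovOrder

open MarkovOrder in
theorem proposition1 (n : ℕ) (Pstar P0 : Fin n → ℝ)
    (hPstar : Pstar ∈ stdSimplex ℝ (Fin n)) (hPstar_pos : ∀ i, 0 < Pstar i)
    (hP0 : P0 ∈ stdSimplex ℝ (Fin n))
    (J : Set (Fin n × Fin n)) (hJ : ∀ i j : Fin n, (i, j) ∈ J → j < i)
    (hne : ∀ i j : Fin n, (i, j) ∈ J → P0 j / Pstar j - P0 i / Pstar i ≠ 0) :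
    ∃ U ∈ 𝓝 P0,
      ((fun v => P0 + v) '' (MarkovOrder.velocityCone J P0 Pstar : Set (Fin n → ℝ))) ∩ U =
        MarkovOrder.reachable Pstar J P0 ∩ U := by
  classical
  have : Fintype J := Fintype.ofFinite J
  have hne' : ∀ e : J, force Pstar e P0 ≠ 0 := fun e => by
    rw [force_apply]
    exact hne _ _ e.2
  have hγ : ∀ (P : Fin n → ℝ) (e : J),
      quadDivergenceDeriv Pstar P (gammaVec e.1.2 e.1.1) = -force Pstar e P := fun P e =>
    quadDivergenceDeriv_gammaVec Pstar P (hJ _ _ e.2)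
  have hcone := eventually_trajectory_mem_cone (fun e : J => gammaVec e.1.2 e.1.1)
    (fun e => force Pstar e) _ _ (hasFDerivAt_quadDivergence Pstar) hγ P0 hne'
  have hreach := eventually_coeff_mem (fun e : J => gammaVec e.1.2 e.1.1)
    (fun e => force Pstar e) _ P0 (hγ P0) hne'
    (eventually_exists_trajectory (fun e : J => gammaVec e.1.2 e.1.1)
      (fun e => force Pstar e) P0 hne')
  refine ⟨_, hcone.and hreach, ?_⟩
  ext y
  refine and_congr_left fun ⟨hyc, hyr⟩ => ⟨?_, ?_⟩
  · rintro ⟨v, hv, rfl⟩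
    obtain ⟨b, hb, rfl⟩ := (mem_velocityCone_iff Pstar P0 hne' v).1 hv
    -- The first `hb` shows that `b` is small enough; the second feeds the sign condition of the
    -- trajectory lemma.
    obtain ⟨w, hw, x, hx0, hx, hx1⟩ := hyr b hb rfl hb
    have hw0 : ∀ i j, (i, j) ∉ J → (if h : (i, j) ∈ J then w ⟨(i, j), h⟩ else 0) = 0 :=
      fun i j h => dif_neg h
    refine ⟨fun i j => if h : (i, j) ∈ J then w ⟨(i, j), h⟩ else 0, ⟨fun i j => ?_, hw0⟩, x,
      ⟨hx0, fun t _ => ?_⟩, 1, one_pos, hx1⟩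
    · dsimp only
      split_ifs with h
      · exact hw _
      · exact le_rfl
    · rw [velocity_eq_sum Pstar hJ hw0]
      simpa using (hx t).hasDerivWithinAt
  · rintro ⟨w, ⟨hw, hw0⟩, x, ⟨hx0, hx⟩, t, ht, hxt⟩
    simp only [velocity_eq_sum Pstar hJ hw0] at hx
    obtain ⟨b, hb, rfl⟩ := hyc (fun e => w e.1.1 e.1.2) (fun e => hw _ _) x hx0 hx t ht.le hxt
    exact ⟨_, (mem_velocityCone_iff Pstar P0 hne' _).2 ⟨b, hb, rfl⟩, rfl⟩
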